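/- Let $p \ge 3$ be a real number. There exists a constant $C_p > 0$, depending only on $p$, such that the following holds for every integer $n \ge 1$ and all real numbers $a_1 \ge a_2 \ge \dots \ge a_n \ge 0$ with $\sum_{i=1}^n a_i^2 = 1$. If $\varepsilon_1, \dots, \varepsilon_n$ are independent Rademacher random variables, i.e. $\mathbb{P}(\varepsilon_i = 1) = \mathbb{P}(\varepsilon_i = -1) = \frac12$ for each $i$, $S = \sum_{i=1}^n a_i \varepsilon_i$, and $G$ is a standard Gaussian random variable, then $$\mathbb{E}|S|^p \le \mathbb{E}|G|^p - C_p \sum_{i=1}^n a_i^4.$$ -/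

import Mathlib

open MeasureTheory ProbabilityTheory
open scoped ENNReal

/-- The Rademacher distribution on `ℝ`: mass `1/2` at `1` and mass `1/2` at `-1`. -/
noncomputable def rademacherReal : Measure ℝ :=
  (1 / 2 : ℝ≥0∞) • Measure.dirac 1 + (1 / 2 : ℝ≥0∞) • Measure.dirac (-1)

/-!
Write `f x = |x| ^ p` and let `symAvg t f y` be the expectation of `f (y + t ε)` for a random sign `ε`.
For `p ≥ 3` the second derivative of `f` is convex, hence `s ↦ symAvg √s f y` is convex in `s`
(`tangent_le_symAvg_abs_rpow`). By Jensen's inequality, `E f (y + a ε) ≤ E f (y + a ξ)` for every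
symmetric `ξ` of variance `1`, and two choices of `ξ` are used.

The choice `ξ = (ε' + g) / √2`, with a sign `ε'` and an independent standard Gaussian `g`, applied to
each term, gives `E f (∑ aᵢ εᵢ) ≤ E f (∑ (aᵢ / √2) εᵢ + g / √2)` (`symAvgList_gaussMoment_le`). From
here on there is a Gaussian component of variance at least `1/2`.

The remaining signs, of sizes `b = aᵢ / √2`, are replaced by Gaussian variables of the same variance.
Each replacement gains a multiple of `b ^ 4`: the defect in Jensen's inequality is nonnegative at every
`y`, its integral over `y ∈ [-2, 2]` is an explicit expression in `|·| ^ p * ·` near the point `2`,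
where that function is smooth with positive fourth derivative
(`sq_le_integral_symAvg_sub_tangent`), and the Gaussian component has density bounded below on this
interval. Integrating in `y` is what allows `p = 3`, where the defect is concentrated near `y = 0`.
The resulting one-step bound `symAvg_gaussMoment_add_le` carries a factor `1 - x ^ 2` in the starting
point `x`, which averages to `1 - x ^ 2 - ∑ b ^ 2` over the other signs, and equals `1/2` at
`x = 0` because `∑ b ^ 2 = 1/2` (`symAvgList_gaussMoment_add_le`).
-/

/-! ### Convexity in the squared variable -/

/-- If `φ'' t - 12 c t ^ 2` is nondecreasing and `φ' 0 = 0`, then `s ↦ φ √s - c s ^ 2` is convex, so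
`s ↦ φ √s` lies above a parabola with leading coefficient `c` that is tangent to it at `s = b ^ 2`. -/
theorem add_parabola_le_of_monotoneOn {T c : ℝ} {φ φ' φ'' : ℝ → ℝ}
    (h1 : ∀ t ∈ Set.Icc 0 T, HasDerivAt φ (φ' t) t)
    (h2 : ∀ t ∈ Set.Icc 0 T, HasDerivAt φ' (φ'' t) t) (h0 : φ' 0 = 0)
    (hm : MonotoneOn (fun t => φ'' t - 12 * c * t ^ 2) (Set.Icc 0 T))
    {b t : ℝ} (hb : 0 < b) (hbT : b ≤ T) (ht : t ∈ Set.Icc 0 T) :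
    φ b + φ' b / (2 * b) * (t ^ 2 - b ^ 2) + c * (t ^ 2 - b ^ 2) ^ 2 ≤ φ t := by
  set ψ : ℝ → ℝ := fun t => φ' t - 4 * c * t ^ 3 with hψ
  have hψd : ∀ t ∈ Set.Icc 0 T, HasDerivAt ψ (φ'' t - 12 * c * t ^ 2) t := by
    intro t ht
    refine ((h2 t ht).sub (((hasDerivAt_id t).pow 3).const_mul (4 * c))).congr_deriv ?_
    simp; ring
  have hψ0 : ψ 0 = 0 := by simp [hψ, h0]
  have hconv : ConvexOn ℝ (Set.Icc 0 T) ψ := by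
    refine MonotoneOn.convexOn_of_deriv (convex_Icc 0 T)
      (fun t ht => (hψd t ht).continuousAt.continuousWithinAt)
      (fun t ht => (hψd t (interior_subset ht)).differentiableAt.differentiableWithinAt) ?_
    intro s hs t ht hst
    rw [(hψd s (interior_subset hs)).deriv, (hψd t (interior_subset ht)).deriv]
    exact hm (interior_subset hs) (interior_subset ht) hst
  -- convexity and `ψ 0 = 0` make `ψ t / t` nondecreasing
  have hslope : ∀ s t : ℝ, 0 ≤ s → s ≤ t → 0 < t → t ≤ T → ψ s ≤ s * (ψ t / t) := by
    intro s t hs hst ht htT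
    have hnn : 0 ≤ 1 - s / t := by rw [sub_nonneg, div_le_one ht]; exact hst
    have h := hconv.2 (show (0 : ℝ) ∈ Set.Icc 0 T from ⟨le_rfl, ht.le.trans htT⟩)
      (show t ∈ Set.Icc 0 T from ⟨ht.le, htT⟩) hnn (show 0 ≤ s / t by positivity) (by ring)
    simp only [smul_eq_mul, mul_zero, zero_add, hψ0] at h
    rw [div_mul_cancel₀ _ ht.ne'] at h
    calc ψ s ≤ s / t * ψ t := h
      _ = _ := by ring
  set Φ : ℝ → ℝ := fun t => φ t - c * t ^ 4 - ψ b / (2 * b) * t ^ 2 with hΦ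
  have hΦd : ∀ t ∈ Set.Icc 0 T, HasDerivAt Φ (ψ t - t * (ψ b / b)) t := by
    intro t ht
    refine (((h1 t ht).sub (((hasDerivAt_id t).pow 4).const_mul c)).sub
      (((hasDerivAt_id t).pow 2).const_mul (ψ b / (2 * b)))).congr_deriv ?_
    simp [hψ]; field_simp
  have key : Φ b ≤ Φ t := by
    rcases le_total t b with htb | hbt
    · have hsub : Set.Icc 0 b ⊆ Set.Icc 0 T := Set.Icc_subset_Icc_right hbT
      have hanti : AntitoneOn Φ (Set.Icc 0 b) := by
        refine antitoneOn_of_deriv_nonpos (convex_Icc 0 b)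
          (fun t ht => (hΦd t (hsub ht)).continuousAt.continuousWithinAt)
          (fun t ht => (hΦd t (hsub (interior_subset ht))).differentiableAt.differentiableWithinAt)
          ?_
        intro x hx
        have hx := interior_subset hx
        rw [(hΦd x (hsub hx)).deriv, sub_nonpos]
        exact hslope x b hx.1 hx.2 hb hbT
      exact hanti ⟨ht.1, htb⟩ ⟨hb.le, le_rfl⟩ htb
    · have hsub : Set.Icc b T ⊆ Set.Icc 0 T := Set.Icc_subset_Icc_left hb.le
      have hmono : MonotoneOn Φ (Set.Icc b T) := by
        refine monotoneOn_of_deriv_nonneg (convex_Icc b T)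
          (fun t ht => (hΦd t (hsub ht)).continuousAt.continuousWithinAt)
          (fun t ht => (hΦd t (hsub (interior_subset ht))).differentiableAt.differentiableWithinAt)
          ?_
        intro x hx
        have hx := interior_subset hx
        rw [(hΦd x (hsub hx)).deriv, sub_nonneg]
        have h := hslope b x hb.le hx.1 (hb.trans_le hx.1) hx.2
        have hx0 := hb.trans_le hx.1
        calc x * (ψ b / b) ≤ x * (b * (ψ x / x) / b) := by gcongr
          _ = ψ x := by field_simp
      exact hmono ⟨le_rfl, hbT⟩ ⟨hbt, ht.2⟩ hbt
  have e : φ b + φ' b / (2 * b) * (t ^ 2 - b ^ 2) + c * (t ^ 2 - b ^ 2) ^ 2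
      = Φ b + c * t ^ 4 + ψ b / (2 * b) * t ^ 2 := by
    simp only [hΦ, hψ]; field_simp; ring
  rw [e]
  simp only [hΦ] at key ⊢
  linarith

/-! ### Symmetric averages -/

/-- The average of `H (x + b)` and `H (x - b)`, that is, the expectation of `H (x + b ε)` for a
Rademacher variable `ε`. -/
noncomputable def symAvg (b : ℝ) (H : ℝ → ℝ) (x : ℝ) : ℝ := (H (x + b) + H (x - b)) / 2

theorem symAvg_zero (H : ℝ → ℝ) (x : ℝ) : symAvg 0 H x = H x := by simp [symAvg]

theorem symAvg_neg (b : ℝ) (H : ℝ → ℝ) (x : ℝ) : symAvg (-b) H x = symAvg b H x := by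
  simp only [symAvg, sub_neg_eq_add, ← sub_eq_add_neg]; ring

theorem symAvg_abs (b : ℝ) (H : ℝ → ℝ) (x : ℝ) : symAvg |b| H x = symAvg b H x := by
  rcases abs_choice b with h | h <;> simp [h, symAvg_neg]

theorem symAvg_mono {H K : ℝ → ℝ} (h : ∀ x, H x ≤ K x) (b x : ℝ) :
    symAvg b H x ≤ symAvg b K x := by
  simp only [symAvg]; linarith [h (x + b), h (x - b)]

theorem symAvg_comm (a b : ℝ) (H : ℝ → ℝ) (x : ℝ) :
    symAvg a (symAvg b H) x = symAvg b (symAvg a H) x := by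
  simp only [symAvg]
  rw [add_right_comm x a b, sub_right_comm x a b, sub_add_eq_add_sub, sub_add_eq_add_sub x b a]
  ring

theorem continuous_symAvg (b : ℝ) {H : ℝ → ℝ} (hH : Continuous H) : Continuous (symAvg b H) := by
  unfold symAvg; fun_prop

/-! ### The power function `|x| ^ p` -/

theorem hasDerivAt_abs_rpow_mul_self {q : ℝ} (hq : 0 < q) (x : ℝ) :
    HasDerivAt (fun x : ℝ => |x| ^ q * x) ((q + 1) * |x| ^ q) x := by
  rcases eq_or_ne x 0 with rfl | hx
  · rw [hasDerivAt_iff_tendsto_slope]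
    have h : Filter.Tendsto (fun x : ℝ => |x| ^ q) (nhdsWithin 0 {0}ᶜ) (nhds ((q + 1) * |0| ^ q)) := by
      have hc : Continuous fun x : ℝ => |x| ^ q := continuous_abs.rpow_const (fun _ => .inr hq.le)
      have := (hc.tendsto 0).mono_left (nhdsWithin_le_nhds (s := {0}ᶜ))
      simpa [hq.ne'] using this
    refine h.congr' ?_
    filter_upwards [self_mem_nhdsWithin] with y hy
    have : y ≠ 0 := hy
    simp [slope_def_field, hq.ne', this]
  · have hx' : 0 < |x| := abs_pos.2 hx
    have h := ((hasDerivAt_abs hx).rpow_const (p := q) (.inl hx'.ne')).mul (hasDerivAt_id x)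
    refine h.congr_deriv ?_
    have e : (SignType.sign x : ℝ) * x = |x| := sign_mul_self x
    rw [Real.rpow_sub_one hx'.ne']
    simp only [id]
    rw [show (SignType.sign x : ℝ) * q * (|x| ^ q / |x|) * x
      = q * (|x| ^ q / |x|) * ((SignType.sign x : ℝ) * x) by ring, e]
    field_simp

theorem convexOn_abs_rpow {q : ℝ} (hq : 1 ≤ q) : ConvexOn ℝ Set.univ fun x : ℝ => |x| ^ q := by
  refine ⟨convex_univ, fun x _ y _ a b ha hb hab => ?_⟩
  have h := (convexOn_rpow hq).2 (abs_nonneg x) (abs_nonneg y) ha hb hab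
  refine le_trans ?_ h
  have h2 : |a • x + b • y| ≤ a • |x| + b • |y| := by
    simp only [smul_eq_mul]
    calc _ ≤ |a * x| + |b * y| := abs_add_le _ _
      _ = _ := by rw [abs_mul, abs_mul, abs_of_nonneg ha, abs_of_nonneg hb]
  exact Real.rpow_le_rpow (abs_nonneg _) h2 (by linarith)

theorem symAvg_le_symAvg_of_convexOn {H : ℝ → ℝ} (hH : ConvexOn ℝ Set.univ H) {s t : ℝ}
    (hs : 0 ≤ s) (hst : s ≤ t) (x : ℝ) : symAvg s H x ≤ symAvg t H x := by
  rcases hs.trans hst |>.eq_or_lt with ht | ht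
  · have : s = t := by linarith
    rw [this]
  · have h0 : 0 ≤ (1 + s / t) / 2 := by positivity
    have h1 : 0 ≤ (1 - s / t) / 2 := by
      have : s / t ≤ 1 := (div_le_one ht).2 hst
      linarith
    have ha := hH.2 (Set.mem_univ (x + t)) (Set.mem_univ (x - t)) h0 h1 (by ring)
    have hb := hH.2 (Set.mem_univ (x + t)) (Set.mem_univ (x - t)) h1 h0 (by ring)
    have ea : ((1 + s / t) / 2) • (x + t) + ((1 - s / t) / 2) • (x - t) = x + s := by
      simp only [smul_eq_mul]; field_simp; ring
    have eb : ((1 - s / t) / 2) • (x + t) + ((1 + s / t) / 2) • (x - t) = x - s := by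
      simp only [smul_eq_mul]; field_simp; ring
    rw [ea] at ha; rw [eb] at hb
    simp only [symAvg, smul_eq_mul] at *
    linarith

/-- The derivative of `s ↦ symAvg √s (|·| ^ p) y` at `s = b ^ 2`. -/
noncomputable def symSlope (p b y : ℝ) : ℝ :=
  (p * |y + b| ^ (p - 2) * (y + b) - p * |y - b| ^ (p - 2) * (y - b)) / (4 * b)

/-- For `p ≥ 3` the map `s ↦ symAvg √s (|·| ^ p) y` is convex, and so lies above its tangent at
`s = b ^ 2`. -/
theorem tangent_le_symAvg_abs_rpow {p : ℝ} (hp : 3 ≤ p) {b : ℝ} (hb : 0 < b) (t y : ℝ) :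
    symAvg b (fun x => |x| ^ p) y + symSlope p b y * (t ^ 2 - b ^ 2)
      ≤ symAvg t (fun x => |x| ^ p) y := by
  rw [← symAvg_abs t, ← sq_abs t]
  have h1 : ∀ z : ℝ, HasDerivAt (fun x : ℝ => |x| ^ p) (p * |z| ^ (p - 2) * z) z :=
    fun z => hasDerivAt_abs_rpow z (by linarith)
  have h2 : ∀ z : ℝ, HasDerivAt (fun x : ℝ => p * |x| ^ (p - 2) * x)
      (p * (p - 1) * |z| ^ (p - 2)) z := by
    intro z
    have h := (hasDerivAt_abs_rpow_mul_self (q := p - 2) (by linarith) z).const_mul p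
    simp only [← mul_assoc] at h
    refine h.congr_deriv ?_
    ring
  have hadd : ∀ t : ℝ, HasDerivAt (fun t => y + t) 1 t := fun t => (hasDerivAt_id t).const_add y
  have hsub : ∀ t : ℝ, HasDerivAt (fun t => y - t) (-1) t := fun t => (hasDerivAt_id t).const_sub y
  have := add_parabola_le_of_monotoneOn (T := max |t| b) (c := 0)
    (φ := fun t => symAvg t (fun x => |x| ^ p) y)
    (φ' := fun t => (p * |y + t| ^ (p - 2) * (y + t) - p * |y - t| ^ (p - 2) * (y - t)) / 2)
    (φ'' := fun t => p * (p - 1) * symAvg t (fun x => |x| ^ (p - 2)) y)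
    (fun t _ => ?_) (fun t _ => ?_) (by simp) ?_ hb (le_max_right _ _)
    (t := |t|) ⟨abs_nonneg t, le_max_left _ _⟩
  · refine le_trans (le_of_eq ?_) this
    simp only [symSlope]
    field_simp
    ring
  · refine ((((h1 (y + t)).comp t (hadd t)).add ((h1 (y - t)).comp t (hsub t))).div_const
      2).congr_deriv ?_
    ring
  · refine ((((h2 (y + t)).comp t (hadd t)).sub ((h2 (y - t)).comp t (hsub t))).div_const
      2).congr_deriv ?_
    simp only [symAvg]
    ring
  · intro s hs t ht hst
    have h := symAvg_le_symAvg_of_convexOn (convexOn_abs_rpow (q := p - 2) (by linarith)) hs.1 hst y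
    have hpp : 0 ≤ p * (p - 1) := mul_nonneg (by linarith) (by linarith)
    simpa using mul_le_mul_of_nonneg_left h hpp

theorem continuous_abs_rpow {q : ℝ} (hq : 0 ≤ q) : Continuous fun x : ℝ => |x| ^ q :=
  continuous_abs.rpow_const (fun _ => .inr hq)

theorem continuous_symSlope {p : ℝ} (hp : 2 ≤ p) (b : ℝ) : Continuous (symSlope p b) := by
  have h := continuous_abs_rpow (q := p - 2) (by linarith)
  have h1 : Continuous fun y : ℝ => |y + b| ^ (p - 2) := h.comp (by fun_prop)
  have h2 : Continuous fun y : ℝ => |y - b| ^ (p - 2) := h.comp (by fun_prop)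
  unfold symSlope
  fun_prop

/-- The distance between `s ↦ symAvg √s (|·| ^ p) y` and its tangent at `s = b ^ 2` may be tiny for
most `y` (for `p = 3` it vanishes when `|y| ≥ max |t| b`), but its integral over `y ∈ [-2, 2]`
is of the order of `(b ^ 2 - t ^ 2) ^ 2`: integration turns `|·| ^ p` into `|·| ^ p * ·`, evaluated
at `2`, where it has positive fourth derivative. -/
theorem sq_le_integral_symAvg_sub_tangent {p : ℝ} (hp : 3 ≤ p) {b t : ℝ} (hb : 0 < b)
    (hb1 : b ≤ 1) (ht : 0 ≤ t) (htb : t ≤ b) :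
    (b ^ 2 - t ^ 2) ^ 2 / 2 ≤ ∫ y in (-2 : ℝ)..2, (symAvg t (fun x => |x| ^ p) y
      - symAvg b (fun x => |x| ^ p) y - symSlope p b y * (t ^ 2 - b ^ 2)) := by
  have hk : ∀ z : ℝ, HasDerivAt (fun x : ℝ => |x| ^ p * x) ((p + 1) * |z| ^ p) z :=
    hasDerivAt_abs_rpow_mul_self (by linarith)
  have h1 : ∀ z : ℝ, HasDerivAt (fun x : ℝ => |x| ^ p) (p * |z| ^ (p - 2) * z) z :=
    fun z => hasDerivAt_abs_rpow z (by linarith)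
  have h2 : ∀ z : ℝ, HasDerivAt (fun x : ℝ => |x| ^ (p - 2) * x)
      ((p - 1) * |z| ^ (p - 2)) z := by
    intro z
    refine (hasDerivAt_abs_rpow_mul_self (q := p - 2) (by linarith) z).congr_deriv ?_
    ring
  have hp1 : p + 1 ≠ 0 := by linarith
  have hl : ∀ c t : ℝ, HasDerivAt (fun t => t + c) 1 t := fun c t => (hasDerivAt_id t).add_const c
  have hl' : ∀ c t : ℝ, HasDerivAt (fun t => t - c) 1 t := fun c t => (hasDerivAt_id t).sub_const c
  set A : ℝ → ℝ := fun y => ((|y + t| ^ p * (y + t) + |y - t| ^ p * (y - t))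
    - (|y + b| ^ p * (y + b) + |y - b| ^ p * (y - b))) / (2 * (p + 1))
    - (|y + b| ^ p - |y - b| ^ p) / (4 * b) * (t ^ 2 - b ^ 2) with hA
  have hAd : ∀ y : ℝ, HasDerivAt A (symAvg t (fun x => |x| ^ p) y
      - symAvg b (fun x => |x| ^ p) y - symSlope p b y * (t ^ 2 - b ^ 2)) y := by
    intro y
    have := (((((hk (y + t)).comp y (hl t y)).add ((hk (y - t)).comp y (hl' t y))).sub
      (((hk (y + b)).comp y (hl b y)).add ((hk (y - b)).comp y (hl' b y)))).div_const
        (2 * (p + 1))).sub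
      (((((h1 (y + b)).comp y (hl b y)).sub ((h1 (y - b)).comp y (hl' b y))).div_const
        (4 * b)).mul_const (t ^ 2 - b ^ 2))
    refine this.congr_deriv ?_
    simp only [symAvg, symSlope]
    field_simp
  have hcont : Continuous fun y => symAvg t (fun x => |x| ^ p) y
      - symAvg b (fun x => |x| ^ p) y - symSlope p b y * (t ^ 2 - b ^ 2) := by
    have hc := continuous_abs_rpow (q := p) (by linarith)
    exact ((continuous_symAvg t hc).sub (continuous_symAvg b hc)).sub
      ((continuous_symSlope (by linarith) b).mul_const _)
  rw [intervalIntegral.integral_eq_sub_of_hasDerivAt (fun y _ => hAd y)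
    (hcont.intervalIntegrable _ _)]
  have hodd : A (-2) = - A 2 := by
    simp only [hA]
    have e : ∀ s : ℝ, |-2 + s| = |2 - s| ∧ |-2 - s| = |2 + s| := fun s =>
      ⟨by rw [← abs_neg]; ring_nf, by rw [← abs_neg]; ring_nf⟩
    simp only [(e t).1, (e t).2, (e b).1, (e b).2]
    ring
  rw [hodd]
  have hadd : ∀ t : ℝ, HasDerivAt (fun t : ℝ => 2 + t) 1 t := fun t =>
    (hasDerivAt_id t).const_add 2
  have hsub : ∀ t : ℝ, HasDerivAt (fun t : ℝ => 2 - t) (-1) t := fun t =>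
    (hasDerivAt_id t).const_sub 2
  have := add_parabola_le_of_monotoneOn (T := 1) (c := 1 / 2)
    (φ := fun t => (|2 + t| ^ p * (2 + t) + |2 - t| ^ p * (2 - t)) / (p + 1))
    (φ' := fun t => |2 + t| ^ p - |2 - t| ^ p)
    (φ'' := fun t => p * (|2 + t| ^ (p - 2) * (2 + t) + |2 - t| ^ (p - 2) * (2 - t)))
    (fun t _ => ?_) (fun t _ => ?_) (by simp) ?_ hb hb1 (t := t) ⟨ht, htb.trans hb1⟩
  · simp only [hA]
    calc (b ^ 2 - t ^ 2) ^ 2 / 2 = 1 / 2 * (t ^ 2 - b ^ 2) ^ 2 := by ring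
      _ ≤ _ := by
        refine (le_sub_iff_add_le'.2 this).trans (le_of_eq ?_)
        field_simp
        ring
  · refine ((((hk (2 + t)).comp t (hadd t)).add ((hk (2 - t)).comp t (hsub t))).div_const
      (p + 1)).congr_deriv ?_
    field_simp
    ring
  · refine (((h1 (2 + t)).comp t (hadd t)).sub ((h1 (2 - t)).comp t (hsub t))).congr_deriv ?_
    ring
  · have hd : ∀ t : ℝ, HasDerivAt
        (fun t => p * (|2 + t| ^ (p - 2) * (2 + t) + |2 - t| ^ (p - 2) * (2 - t))
          - 12 * (1 / 2) * t ^ 2)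
        (p * (p - 1) * (|2 + t| ^ (p - 2) - |2 - t| ^ (p - 2)) - 12 * t) t := by
      intro t
      refine (((((h2 (2 + t)).comp t (hadd t)).add
        ((h2 (2 - t)).comp t (hsub t))).const_mul p).sub
        (((hasDerivAt_id t).pow 2).const_mul (12 * (1 / 2)))).congr_deriv ?_
      simp
      ring
    refine monotoneOn_of_deriv_nonneg (convex_Icc 0 1)
      (fun t _ => (hd t).continuousAt.continuousWithinAt)
      (fun t _ => (hd t).differentiableAt.differentiableWithinAt) ?_
    intro s hs
    obtain ⟨hs0, hs1⟩ := interior_subset hs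
    rw [(hd s).deriv, abs_of_pos (by linarith), abs_of_pos (by linarith)]
    have hge : 1 ≤ (2 - s) ^ (p - 3) := Real.one_le_rpow (by linarith) (by linarith)
    have hmon : (2 - s) ^ (p - 3) ≤ (2 + s) ^ (p - 3) :=
      Real.rpow_le_rpow (by linarith) (by linarith) (by linarith)
    have e : ∀ z : ℝ, 0 < z → z ^ (p - 2) = z ^ (p - 3) * z := by
      intro z hz
      rw [← Real.rpow_add_one hz.ne']
      ring_nf
    rw [e _ (by linarith), e _ (by linarith)]
    have hdiff : 2 * s ≤ (2 + s) ^ (p - 3) * (2 + s) - (2 - s) ^ (p - 3) * (2 - s) := by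
      nlinarith
    have hpp : 6 ≤ p * (p - 1) := by nlinarith
    nlinarith

/-! ### Gaussian averages of `|x| ^ p` -/

open scoped NNReal

/-- The `p`-th absolute moment of the Gaussian law with mean `x` and variance `v`. -/
noncomputable def gaussMoment (p : ℝ) (v : ℝ≥0) (x : ℝ) : ℝ :=
  ∫ y, |x + y| ^ p ∂gaussianReal 0 v

theorem integrable_abs_add_rpow_gaussianReal {q : ℝ} (hq : 0 ≤ q) (v : ℝ≥0) (x : ℝ) :
    Integrable (fun y => |x + y| ^ q) (gaussianReal 0 v) := by
  have h : MemLp (fun y : ℝ => x + y) (ENNReal.ofReal q) (gaussianReal 0 v) :=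
    (memLp_const x).add (memLp_id_gaussianReal' (μ := 0) (v := v) _ ENNReal.ofReal_ne_top)
  simpa [ENNReal.toReal_ofReal hq] using h.integrable_norm_rpow'

theorem integrable_symSlope_gaussianReal {p : ℝ} (hp : 2 ≤ p) (v : ℝ≥0) (b x : ℝ) :
    Integrable (fun y => symSlope p b (x + y)) (gaussianReal 0 v) := by
  have key : ∀ c : ℝ, Integrable (fun y => p * |x + y + c| ^ (p - 2) * (x + y + c))
      (gaussianReal 0 v) := by
    intro c
    have h := (integrable_abs_add_rpow_gaussianReal (q := p - 1) (by linarith) v (x + c)).const_mul p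
    refine h.mono' ?_ (.of_forall fun y => ?_)
    · have hc := continuous_abs_rpow (q := p - 2) (by linarith)
      have h1 : Continuous fun y : ℝ => |x + y + c| ^ (p - 2) := hc.comp (by fun_prop)
      exact Continuous.aestronglyMeasurable (by fun_prop)
    · rw [add_right_comm x c y]
      rcases eq_or_ne (x + y + c) 0 with h0 | h0
      · rw [h0, mul_zero, norm_zero]
        have := Real.rpow_nonneg (abs_nonneg (0 : ℝ)) (p - 1)
        nlinarith
      · have hpos := abs_pos.2 h0
        rw [norm_mul, norm_mul, Real.norm_eq_abs, Real.norm_eq_abs, Real.norm_eq_abs,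
          abs_of_nonneg (by linarith : (0 : ℝ) ≤ p),
          abs_of_nonneg (Real.rpow_nonneg (abs_nonneg _) _), mul_assoc,
          ← Real.rpow_add_one hpos.ne']
        ring_nf
        rfl
  have := ((key b).sub (key (-b))).div_const (4 * b)
  refine this.congr (.of_forall fun y => ?_)
  simp [symSlope, ← sub_eq_add_neg]

theorem integrable_symAvg_gaussianReal {p : ℝ} (hp : 0 ≤ p) (v : ℝ≥0) (t x : ℝ) :
    Integrable (fun y => symAvg t (fun x => |x| ^ p) (x + y)) (gaussianReal 0 v) := by
  have h1 := integrable_abs_add_rpow_gaussianReal hp v (x + t)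
  have h2 := integrable_abs_add_rpow_gaussianReal hp v (x - t)
  refine ((h1.add h2).div_const 2).congr (.of_forall fun y => ?_)
  simp only [symAvg, Pi.add_apply, add_right_comm x t y, sub_add_eq_add_sub x t y]

theorem symAvg_gaussMoment {p : ℝ} (hp : 0 ≤ p) (v : ℝ≥0) (t x : ℝ) :
    symAvg t (gaussMoment p v) x = ∫ y, symAvg t (fun x => |x| ^ p) (x + y) ∂gaussianReal 0 v := by
  have h1 := integrable_abs_add_rpow_gaussianReal hp v (x + t)
  have h2 := integrable_abs_add_rpow_gaussianReal hp v (x - t)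
  simp only [symAvg, gaussMoment]
  rw [← integral_add h1 h2, ← integral_div]
  refine integral_congr_ae (.of_forall fun y => ?_)
  simp only [add_right_comm x t y, sub_add_eq_add_sub x t y]

/-- The Gaussian average of `symSlope`. -/
noncomputable def gaussSlope (p : ℝ) (v : ℝ≥0) (b x : ℝ) : ℝ :=
  ∫ y, symSlope p b (x + y) ∂gaussianReal 0 v

theorem symAvg_gaussMoment_sub_tangent {p : ℝ} (hp : 2 ≤ p) (v : ℝ≥0) (b t x : ℝ) :
    symAvg t (gaussMoment p v) x - symAvg b (gaussMoment p v) x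
      - gaussSlope p v b x * (t ^ 2 - b ^ 2)
    = ∫ y, (symAvg t (fun x => |x| ^ p) (x + y) - symAvg b (fun x => |x| ^ p) (x + y)
      - symSlope p b (x + y) * (t ^ 2 - b ^ 2)) ∂gaussianReal 0 v := by
  have h0 : 0 ≤ p := by linarith
  have hs := (integrable_symSlope_gaussianReal hp v b x).mul_const (t ^ 2 - b ^ 2)
  have ht := integrable_symAvg_gaussianReal h0 v t x
  have hb := integrable_symAvg_gaussianReal h0 v b x
  rw [symAvg_gaussMoment h0, symAvg_gaussMoment h0, gaussSlope, ← integral_mul_const,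
    ← integral_sub ht hb]
  exact (integral_sub (ht.sub hb) hs).symm

theorem tangent_le_symAvg_gaussMoment {p : ℝ} (hp : 3 ≤ p) (v : ℝ≥0) {b : ℝ} (hb : 0 < b)
    (t x : ℝ) :
    symAvg b (gaussMoment p v) x + gaussSlope p v b x * (t ^ 2 - b ^ 2)
      ≤ symAvg t (gaussMoment p v) x := by
  have h := symAvg_gaussMoment_sub_tangent (p := p) (by linarith) v b t x
  have : 0 ≤ ∫ y, (symAvg t (fun x => |x| ^ p) (x + y) - symAvg b (fun x => |x| ^ p) (x + y)
      - symSlope p b (x + y) * (t ^ 2 - b ^ 2)) ∂gaussianReal 0 v :=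
    integral_nonneg fun y => by
      have := tangent_le_symAvg_abs_rpow hp hb t (x + y)
      simp only [Pi.zero_apply]
      linarith
  linarith

/-- A lower bound, on `[-2, 2]`, for the density of a Gaussian law whose variance lies in `[1/2, 1]`
and whose mean lies in `[-1, 1]`. -/
noncomputable def gaussDensityBound : ℝ := (√(2 * Real.pi))⁻¹ * Real.exp (-9)

theorem gaussDensityBound_pos : 0 < gaussDensityBound := by
  have := Real.pi_pos
  unfold gaussDensityBound
  positivity

theorem gaussDensityBound_le {v : ℝ≥0} (hv : 1 / 2 ≤ (v : ℝ)) (hv1 : (v : ℝ) ≤ 1) {x y : ℝ}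
    (hx : |x| ≤ 1) (hy : |y| ≤ 2) : gaussDensityBound ≤ gaussianPDFReal x v y := by
  have hpi := Real.pi_pos
  have hv0 : (0 : ℝ) < v := by linarith
  unfold gaussDensityBound gaussianPDFReal
  have hyx : |y - x| ≤ 3 := (abs_sub _ _).trans (by linarith)
  have hsq : (y - x) ^ 2 ≤ 9 := by
    rw [← sq_abs]; nlinarith [abs_nonneg (y - x)]
  have hsqrt : √(2 * Real.pi * v) ≤ √(2 * Real.pi) := Real.sqrt_le_sqrt (by nlinarith)
  have hexp : -9 ≤ -(y - x) ^ 2 / (2 * v) := by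
    rw [neg_div, neg_le_neg_iff, div_le_iff₀ (by linarith)]
    linarith
  gcongr

theorem mul_intervalIntegral_le_integral_gaussianReal {v : ℝ≥0} (hv : 1 / 2 ≤ (v : ℝ))
    (hv1 : (v : ℝ) ≤ 1) {x : ℝ} (hx : |x| ≤ 1) {e : ℝ → ℝ} (he : ∀ y, 0 ≤ e y)
    (hem : Measurable e) (hi : Integrable (fun y => e (x + y)) (gaussianReal 0 v)) :
    gaussDensityBound * ∫ y in (-2 : ℝ)..2, e y ≤ ∫ y, e (x + y) ∂gaussianReal 0 v := by
  have hmap : (gaussianReal 0 v).map (x + ·) = gaussianReal x v := by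
    rw [gaussianReal_map_const_add, zero_add]
  have hi' : Integrable e (gaussianReal x v) := by
    rw [← hmap, integrable_map_measure hem.aestronglyMeasurable (by fun_prop)]
    exact hi
  have e1 : ∫ y, e (x + y) ∂gaussianReal 0 v = ∫ y, e y ∂gaussianReal x v := by
    rw [← hmap, integral_map (by fun_prop) hem.aestronglyMeasurable]
  have hv0 : v ≠ 0 := by
    rintro rfl
    norm_num at hv
  have hle : ENNReal.ofReal gaussDensityBound • volume.restrict (Set.Ioc (-2 : ℝ) 2)
      ≤ gaussianReal x v := by
    rw [gaussianReal_of_var_ne_zero _ hv0, ← withDensity_const,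
      ← withDensity_indicator measurableSet_Ioc]
    refine withDensity_mono (.of_forall fun y => ?_)
    refine Set.indicator_le (fun y hy => ?_) y
    refine ENNReal.ofReal_le_ofReal (gaussDensityBound_le hv hv1 hx ?_)
    exact abs_le.2 ⟨hy.1.le, hy.2⟩
  have := integral_mono_measure hle (.of_forall he) hi'
  rw [integral_smul_measure, ENNReal.toReal_ofReal gaussDensityBound_pos.le] at this
  rw [e1, intervalIntegral.integral_of_le (by norm_num)]
  exact this

/-- After Gaussian averaging the gap above the tangent is bounded below pointwise: it is nonnegative
everywhere, and the Gaussian density is bounded below on `[-2, 2]`. -/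
theorem tangent_add_sq_le_symAvg_gaussMoment {p : ℝ} (hp : 3 ≤ p) {v : ℝ≥0} (hv : 1 / 2 ≤ (v : ℝ))
    (hv1 : (v : ℝ) ≤ 1) {b t x : ℝ} (hb : 0 < b) (hb1 : b ≤ 1) (htb : |t| ≤ b) (hx : |x| ≤ 1) :
    symAvg b (gaussMoment p v) x + gaussSlope p v b x * (t ^ 2 - b ^ 2)
      + gaussDensityBound / 2 * (b ^ 2 - t ^ 2) ^ 2 ≤ symAvg t (gaussMoment p v) x := by
  rw [← symAvg_abs t, ← sq_abs t]
  have h := symAvg_gaussMoment_sub_tangent (p := p) (by linarith) v b |t| x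
  have h0 : 0 ≤ p := by linarith
  have hc := continuous_abs_rpow h0
  have h1 := mul_intervalIntegral_le_integral_gaussianReal hv hv1 hx
    (e := fun y => symAvg |t| (fun x => |x| ^ p) y
      - symAvg b (fun x => |x| ^ p) y - symSlope p b y * (|t| ^ 2 - b ^ 2))
    (fun y => by linarith [tangent_le_symAvg_abs_rpow hp hb |t| y])
    (((continuous_symAvg |t| hc).sub (continuous_symAvg b hc)).sub
      ((continuous_symSlope (by linarith) b).mul_const _)).measurable
    (((integrable_symAvg_gaussianReal h0 v |t| x).sub (integrable_symAvg_gaussianReal h0 v b x)).sub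
      ((integrable_symSlope_gaussianReal (by linarith) v b x).mul_const _))
  have h2 := mul_le_mul_of_nonneg_left
    (sq_le_integral_symAvg_sub_tangent hp hb hb1 (abs_nonneg t) htb) gaussDensityBound_pos.le
  linarith

theorem map_mul_gaussianReal_one (b : ℝ≥0) :
    (gaussianReal 0 1).map ((b : ℝ) * ·) = gaussianReal 0 (b ^ 2) := by
  rw [gaussianReal_map_const_mul, mul_zero, mul_one]
  congr 1

theorem continuous_gaussMoment {p : ℝ} (hp : 1 < p) (v : ℝ≥0) : Continuous (gaussMoment p v) := by
  have h0 : 0 ≤ p := by linarith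
  refine continuous_iff_continuousAt.2 fun x => ?_
  have hi := (integrable_abs_add_rpow_gaussianReal h0 v (x + 1)).add
    (integrable_abs_add_rpow_gaussianReal h0 v (x - 1))
  refine continuousAt_of_dominated (.of_forall fun z => ?_) ?_ hi (.of_forall fun y => ?_)
  · exact (integrable_abs_add_rpow_gaussianReal h0 v z).aestronglyMeasurable
  · filter_upwards [Metric.closedBall_mem_nhds x one_pos] with z hz
    refine .of_forall fun y => ?_
    rw [Metric.mem_closedBall, Real.dist_eq] at hz
    rw [Real.norm_of_nonneg (Real.rpow_nonneg (abs_nonneg _) _)]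
    obtain ⟨hz1, hz2⟩ := abs_le.1 hz
    have n1 := Real.rpow_nonneg (abs_nonneg (x + 1 + y)) p
    have n2 := Real.rpow_nonneg (abs_nonneg (x - 1 + y)) p
    rcases le_total 0 (z + y) with h | h
    · have : |z + y| ^ p ≤ |x + 1 + y| ^ p := Real.rpow_le_rpow (abs_nonneg _)
        (abs_le_abs_of_nonneg h (by linarith)) h0
      simp only [Pi.add_apply]; linarith
    · have : |z + y| ^ p ≤ |x - 1 + y| ^ p := Real.rpow_le_rpow (abs_nonneg _)
        (abs_le_abs_of_nonpos h (by linarith)) h0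
      simp only [Pi.add_apply]; linarith
  · exact ((continuous_abs_rpow h0).comp (continuous_add_const y)).continuousAt

theorem integrable_gaussMoment_add_mul {p : ℝ} (hp : 1 < p) (v b : ℝ≥0) (x : ℝ) :
    Integrable (fun z => gaussMoment p v (x + b * z)) (gaussianReal 0 1) := by
  have h0 : 0 ≤ p := by linarith
  have hi := integrable_abs_add_rpow_gaussianReal h0 (b ^ 2 + v) x
  have hconv := gaussianReal_conv_gaussianReal (m₁ := 0) (m₂ := 0) (v₁ := b ^ 2) (v₂ := v)
  rw [add_zero] at hconv
  rw [← hconv] at hi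
  have h := ((integrable_conv_iff hi.aestronglyMeasurable).1 hi).2
  rw [← map_mul_gaussianReal_one] at h
  refine (h.comp_aemeasurable (by fun_prop)).congr (.of_forall fun z => ?_)
  simp only [Function.comp, gaussMoment]
  refine integral_congr_ae (.of_forall fun y => ?_)
  simp only
  rw [Real.norm_of_nonneg (Real.rpow_nonneg (abs_nonneg _) _), add_assoc]

/-- The semigroup property of the Gaussian laws. -/
theorem integral_gaussMoment_add_mul {p : ℝ} (hp : 1 < p) (v b : ℝ≥0) (x : ℝ) :
    ∫ z, gaussMoment p v (x + b * z) ∂gaussianReal 0 1 = gaussMoment p (v + b ^ 2) x := by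
  have h0 : 0 ≤ p := by linarith
  have hi := integrable_abs_add_rpow_gaussianReal h0 (b ^ 2 + v) x
  have hconv := gaussianReal_conv_gaussianReal (m₁ := 0) (m₂ := 0) (v₁ := b ^ 2) (v₂ := v)
  rw [add_zero] at hconv
  have e := integral_conv (μ := gaussianReal 0 (b ^ 2)) (ν := gaussianReal 0 v) (by rwa [hconv])
  have hm : Continuous fun z => gaussMoment p v (x + z) :=
    (continuous_gaussMoment hp v).comp (by fun_prop)
  rw [gaussMoment, add_comm v, ← hconv, e, ← map_mul_gaussianReal_one]
  simp_rw [← add_assoc]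
  exact (integral_map (by fun_prop) hm.aestronglyMeasurable).symm

theorem measurePreserving_neg_gaussianReal (v : ℝ≥0) :
    MeasurePreserving (fun z : ℝ => -z) (gaussianReal 0 v) (gaussianReal 0 v) :=
  ⟨measurable_neg, by rw [gaussianReal_map_neg, neg_zero]⟩

theorem integrable_sq_gaussianReal : Integrable (fun z : ℝ => z ^ 2) (gaussianReal 0 1) := by
  simpa using (memLp_id_gaussianReal (μ := 0) (v := 1) 2).integrable_sq

theorem integrable_id_gaussianReal : Integrable (fun z : ℝ => z) (gaussianReal 0 1) :=
  memLp_one_iff_integrable.1 (memLp_id_gaussianReal (μ := 0) (v := 1) 1)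

theorem integral_sq_gaussianReal : ∫ z : ℝ, z ^ 2 ∂gaussianReal 0 1 = 1 := by
  have h := variance_fun_id_gaussianReal (μ := 0) (v := 1)
  rw [variance_of_integral_eq_zero (by fun_prop) (by simp)] at h
  simpa using h

/-! ### One-step comparisons -/

/-- Adding an independent Gaussian variable `b G` to `c ε`, for a Rademacher variable `ε`, gives the
same law as the variable `(c + b G) ε`. -/
theorem integral_symAvg_gaussMoment {p : ℝ} (hp : 1 < p) (v b : ℝ≥0) (c x : ℝ) :
    Integrable (fun z => symAvg (c + b * z) (gaussMoment p v) x) (gaussianReal 0 1) ∧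
    ∫ z, symAvg (c + b * z) (gaussMoment p v) x ∂gaussianReal 0 1
      = symAvg c (gaussMoment p (v + b ^ 2)) x := by
  have hneg := measurePreserving_neg_gaussianReal 1
  have h1 := integrable_gaussMoment_add_mul hp v b (x + c)
  have h2 := integrable_gaussMoment_add_mul hp v b (x - c)
  have h3 : Integrable (fun z => gaussMoment p v (x - c + b * (-z))) (gaussianReal 0 1) :=
    hneg.integrable_comp_of_integrable h2
  have e : (fun z => symAvg (c + b * z) (gaussMoment p v) x) = fun z =>
      (gaussMoment p v (x + c + b * z) + gaussMoment p v (x - c + b * (-z))) / 2 := by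
    funext z
    simp only [symAvg]
    ring_nf
  rw [e]
  refine ⟨(h1.add h3).div_const 2, ?_⟩
  rw [integral_div, integral_add h1 h3,
    hneg.integral_comp (MeasurableEquiv.neg ℝ).measurableEmbedding
      (fun z => gaussMoment p v (x - c + b * z)),
    integral_gaussMoment_add_mul hp, integral_gaussMoment_add_mul hp]
  rfl

/-- A Rademacher variable of size `√2 b` is dominated by the sum of a Rademacher variable and an
independent Gaussian one, both of standard deviation `b`. -/
theorem symAvg_gaussMoment_le_symAvg {p : ℝ} (hp : 3 ≤ p) (v b : ℝ≥0) (x : ℝ) :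
    symAvg (√2 * b) (gaussMoment p v) x ≤ symAvg b (gaussMoment p (v + b ^ 2)) x := by
  rcases eq_or_ne b 0 with rfl | hb
  · simp
  have hb0 : (0 : ℝ) < √2 * b := by positivity
  obtain ⟨hi, he⟩ := integral_symAvg_gaussMoment (p := p) (by linarith) v b b x
  rw [← he]
  have hpt : ∀ z : ℝ, symAvg (√2 * b) (gaussMoment p v) x
      + (gaussSlope p v (√2 * b) x * b ^ 2) * (z ^ 2 + 2 * z - 1)
      ≤ symAvg (b + b * z) (gaussMoment p v) x := by
    intro z
    refine le_trans (le_of_eq ?_) (tangent_le_symAvg_gaussMoment hp v hb0 (b + b * z) x)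
    rw [mul_pow √2, Real.sq_sqrt (by norm_num)]
    ring
  have hiq := (integrable_sq_gaussianReal.add (integrable_id_gaussianReal.const_mul 2)).sub
    (integrable_const 1)
  have hi1 := hiq.const_mul (gaussSlope p v (√2 * b) x * b ^ 2)
  have hi0 := integrable_const (μ := gaussianReal 0 1) (symAvg (√2 * b) (gaussMoment p v) x)
  refine le_trans (le_of_eq ?_) (integral_mono (hi0.add hi1) hi hpt)
  rw [integral_add' hi0 hi1, integral_const_mul,
    integral_sub' (integrable_sq_gaussianReal.add (integrable_id_gaussianReal.const_mul 2))
      (integrable_const 1),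
    integral_add' integrable_sq_gaussianReal (integrable_id_gaussianReal.const_mul 2),
    integral_sq_gaussianReal, integral_const_mul, integral_id_gaussianReal]
  simp

/-- The gain, in units of `b ^ 4`, in replacing a Rademacher variable of size `b` by a Gaussian
one. -/
noncomputable def gainConst : ℝ :=
  gaussDensityBound / 2 * ∫ z : ℝ, (max 0 (1 - z ^ 2)) ^ 2 ∂gaussianReal 0 1

theorem integrable_max_sq_gaussianReal :
    Integrable (fun z : ℝ => (max 0 (1 - z ^ 2)) ^ 2) (gaussianReal 0 1) := by
  refine (integrable_const (1 : ℝ)).mono' (by fun_prop) (.of_forall fun z => ?_)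
  rw [Real.norm_of_nonneg (by positivity)]
  exact pow_le_one₀ (le_max_left _ _) (max_le zero_le_one (by linarith [sq_nonneg z]))

theorem gainConst_pos : 0 < gainConst := by
  refine mul_pos (half_pos gaussDensityBound_pos) ?_
  rw [integral_pos_iff_support_of_nonneg (fun z => by positivity) integrable_max_sq_gaussianReal]
  have hsub : Set.Ioo (-1 : ℝ) 1 ⊆ Function.support fun z : ℝ => (max 0 (1 - z ^ 2)) ^ 2 := by
    intro z hz
    have : 0 < 1 - z ^ 2 := by nlinarith [hz.1, hz.2]
    simp only [Function.mem_support]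
    rw [max_eq_right this.le]
    positivity
  refine lt_of_lt_of_le ?_ (measure_mono hsub)
  rw [pos_iff_ne_zero]
  intro h
  have := gaussianReal_absolutelyContinuous' 0 one_ne_zero h
  norm_num [Real.volume_Ioo] at this

/-- Replacing `b ε` by `b G`, in the presence of a Gaussian component of variance `v ≥ 1/2`, gains a
multiple of `b ^ 4`, as long as `|x| < 1`. The factor `1 - x ^ 2` also makes the inequality true for
all other `x`, and it averages well over the remaining signs. -/
theorem symAvg_gaussMoment_add_le {p : ℝ} (hp : 3 ≤ p) {v b : ℝ≥0} (hv : 1 / 2 ≤ (v : ℝ))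
    (hv1 : (v : ℝ) ≤ 1) (hb1 : b ≤ 1) (x : ℝ) :
    symAvg b (gaussMoment p v) x + gainConst * b ^ 4 * (1 - x ^ 2)
      ≤ gaussMoment p (v + b ^ 2) x := by
  rcases eq_or_ne b 0 with rfl | hb
  · simp [symAvg]
  have hb0 : (0 : ℝ) < b := by positivity
  have hb1' : (b : ℝ) ≤ 1 := hb1
  obtain ⟨hi, he⟩ := integral_symAvg_gaussMoment (p := p) (by linarith) v b 0 x
  simp only [zero_add, symAvg_zero] at hi he
  rw [← he]
  -- the gap above the tangent is used for `|z| ≤ 1` only, where `|b * z| ≤ b`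
  have hpt : ∀ z : ℝ, symAvg b (gaussMoment p v) x
      + (gaussSlope p v b x * b ^ 2) * (z ^ 2 - 1)
      + (gaussDensityBound / 2 * b ^ 4 * (1 - x ^ 2)) * (max 0 (1 - z ^ 2)) ^ 2
      ≤ symAvg (b * z) (gaussMoment p v) x := by
    intro z
    have hpos := gaussDensityBound_pos
    have h1 := tangent_le_symAvg_gaussMoment hp v hb0 (b * z) x
    by_cases hx : |x| ≤ 1 ∧ |z| ≤ 1
    · obtain ⟨hx, hz⟩ := hx
      have hbz : |b * z| ≤ b := by
        rw [abs_mul, abs_of_pos hb0]; exact mul_le_of_le_one_right hb0.le hz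
      have h2 := tangent_add_sq_le_symAvg_gaussMoment hp hv hv1 hb0 hb1' hbz hx
      have hz2 : z ^ 2 ≤ 1 := (sq_le_one_iff_abs_le_one z).2 hz
      rw [max_eq_right (by linarith)]
      have : 0 ≤ gaussDensityBound / 2 * b ^ 4 * (1 - z ^ 2) ^ 2 * x ^ 2 := by positivity
      nlinarith
    · have : (gaussDensityBound / 2 * b ^ 4 * (1 - x ^ 2)) * (max 0 (1 - z ^ 2)) ^ 2 ≤ 0 := by
        rw [not_and_or, not_le, not_le] at hx
        rcases hx with hx | hz
        · have : 1 - x ^ 2 ≤ 0 := by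
            have := (one_lt_sq_iff_one_lt_abs x).2 hx
            linarith
          exact mul_nonpos_of_nonpos_of_nonneg
            (mul_nonpos_of_nonneg_of_nonpos (by positivity) this) (by positivity)
        · have := (one_lt_sq_iff_one_lt_abs z).2 hz
          rw [max_eq_left (by linarith)]
          simp
      nlinarith
  have hi1 : Integrable (fun z : ℝ => (gaussSlope p v b x * b ^ 2) * (z ^ 2 - 1))
      (gaussianReal 0 1) := (integrable_sq_gaussianReal.sub (integrable_const 1)).const_mul _
  have hi2 := integrable_max_sq_gaussianReal.const_mul
    (gaussDensityBound / 2 * b ^ 4 * (1 - x ^ 2))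
  have hi0 := integrable_const (μ := gaussianReal 0 1) (symAvg b (gaussMoment p v) x)
  have := integral_mono ((hi0.add hi1).add hi2) hi hpt
  refine le_trans (le_of_eq ?_) this
  rw [integral_add' (hi0.add hi1) hi2, integral_add' hi0 hi1, integral_const_mul,
    integral_const_mul, integral_sub integrable_sq_gaussianReal (integrable_const 1),
    integral_sq_gaussianReal]
  simp [gainConst]
  ring

/-! ### Iterated symmetric averages -/

/-- The expectation of `H (x + ∑ aᵢ εᵢ)` over independent signs `εᵢ`, where `aᵢ` runs through the
given list. -/
noncomputable def symAvgList : List ℝ → (ℝ → ℝ) → ℝ → ℝ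
  | [], H => H
  | b :: l, H => symAvg b (symAvgList l H)

theorem symAvgList_mono {H K : ℝ → ℝ} (h : ∀ x, H x ≤ K x) :
    ∀ (l : List ℝ) (x : ℝ), symAvgList l H x ≤ symAvgList l K x
  | [], x => h x
  | b :: l, x => symAvg_mono (symAvgList_mono h l) b x

theorem symAvgList_symAvg (b : ℝ) (H : ℝ → ℝ) :
    ∀ l : List ℝ, symAvgList l (symAvg b H) = symAvg b (symAvgList l H)
  | [] => rfl
  | a :: l => by
    funext x
    rw [symAvgList, symAvgList_symAvg b H l, symAvg_comm]
    rfl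

/-- Each sign of size `√2 b` may be traded for a sign of size `b` together with a Gaussian component of
variance `b ^ 2`. -/
theorem symAvgList_gaussMoment_le {p : ℝ} (hp : 3 ≤ p) :
    ∀ (l : List ℝ≥0) (v : ℝ≥0) (x : ℝ),
      symAvgList (l.map fun b : ℝ≥0 => √2 * (b : ℝ)) (gaussMoment p v) x
        ≤ symAvgList (l.map NNReal.toReal) (gaussMoment p (v + (l.map fun b => b ^ 2).sum)) x
  | [], v, x => by simp [symAvgList]
  | b :: l, v, x => by
    simp only [List.map_cons, symAvgList, List.sum_cons]
    rw [← symAvgList_symAvg, ← symAvgList_symAvg]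
    refine (symAvgList_mono (symAvg_gaussMoment_le_symAvg hp v b) _ x).trans ?_
    rw [symAvgList_symAvg, symAvgList_symAvg, ← add_assoc]
    exact symAvg_mono (symAvgList_gaussMoment_le hp l (v + b ^ 2)) b x

/-- The one-step gains add up. The factor `1 - x ^ 2 - ∑ b ^ 2` is preserved by the induction because
the average of `(x ± b) ^ 2` is `x ^ 2 + b ^ 2`. -/
theorem symAvgList_gaussMoment_add_le {p : ℝ} (hp : 3 ≤ p) {v : ℝ≥0} (hv : 1 / 2 ≤ (v : ℝ)) :
    ∀ (l : List ℝ≥0), ((v + (l.map fun b => b ^ 2).sum : ℝ≥0) : ℝ) ≤ 1 → ∀ x : ℝ,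
      symAvgList (l.map NNReal.toReal) (gaussMoment p v) x
        + gainConst * ((l.map fun b => b ^ 4).sum : ℝ≥0)
          * (1 - x ^ 2 - ((l.map fun b => b ^ 2).sum : ℝ≥0))
        ≤ gaussMoment p (v + (l.map fun b => b ^ 2).sum) x
  | [], _, x => by simp [symAvgList]
  | b :: l, h, x => by
    simp only [List.map_cons, symAvgList, List.sum_cons] at h ⊢
    set s := (l.map fun b => b ^ 2).sum with hs
    set q := (l.map fun b => b ^ 4).sum with hq
    push_cast at h
    have hv0 := v.2
    have hs0 := s.2
    have hsb := sq_nonneg (b : ℝ)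
    have hg := gainConst_pos
    have IH := symAvgList_gaussMoment_add_le hp hv l (by push_cast; linarith)
    have hb1 : b ≤ 1 := by
      have : (b : ℝ) ≤ 1 := by nlinarith
      exact_mod_cast this
    have hstep := symAvg_gaussMoment_add_le hp (v := v + s) (b := b)
      (by push_cast; linarith) (by push_cast; linarith) hb1 x
    have h1 := IH (x + b)
    have h2 := IH (x - b)
    rw [show v + (b ^ 2 + s) = v + s + b ^ 2 by ring]
    simp only [symAvg] at hstep ⊢
    have hnn : 0 ≤ gainConst * (b : ℝ) ^ 4 * ((b : ℝ) ^ 2 + s) := by positivity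
    push_cast
    simp only [← hs, ← hq] at h1 h2
    nlinarith

/-! ### Rademacher sums -/

theorem ae_eq_one_or_neg_one_of_hasLaw {Ω : Type*} [MeasurableSpace Ω] {P : Measure Ω} {ε : Ω → ℝ}
    (h : HasLaw ε rademacherReal P) : ∀ᵐ ω ∂P, ε ω = 1 ∨ ε ω = -1 := by
  refine ae_of_ae_map h.aemeasurable (p := fun x => x = 1 ∨ x = -1) ?_
  rw [h.map_eq, rademacherReal, ae_add_measure_iff]
  constructor <;> refine Measure.ae_smul_measure ?_ _ <;> rw [ae_dirac_eq] <;> simp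

theorem integral_of_hasLaw_rademacherReal {Ω : Type*} [MeasurableSpace Ω] {P : Measure Ω}
    {ε : Ω → ℝ} (h : HasLaw ε rademacherReal P) (g : ℝ → ℝ) (hg : Continuous g) :
    Integrable (fun ω => g (ε ω)) P ∧ ∫ ω, g (ε ω) ∂P = (g 1 + g (-1)) / 2 := by
  have hi : ∀ x : ℝ, Integrable g ((1 / 2 : ℝ≥0∞) • Measure.dirac x) := fun x =>
    (integrable_dirac (by simp)).smul_measure (by simp)
  have hI : Integrable g (P.map ε) := by
    rw [h.map_eq, rademacherReal]
    exact (hi 1).add_measure (hi (-1))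
  refine ⟨hI.comp_aemeasurable h.aemeasurable, ?_⟩
  rw [← integral_map h.aemeasurable hg.aestronglyMeasurable, h.map_eq, rademacherReal,
    integral_add_measure (hi 1) (hi (-1)), integral_smul_measure, integral_smul_measure,
    integral_dirac, integral_dirac]
  simp
  ring

/-- The expectation of `H (x + ∑ aᵢ εᵢ)`, by conditioning on the first sign; integrability is carried
along in the induction. -/
theorem integral_rademacher_sum {Ω : Type*} [MeasurableSpace Ω] {P : Measure Ω}
    [IsProbabilityMeasure P] {H : ℝ → ℝ} (hH : Continuous H) :
    ∀ (n : ℕ) (a : Fin n → ℝ) (ε : Fin n → Ω → ℝ), (∀ i, HasLaw (ε i) rademacherReal P) →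
      iIndepFun ε P → ∀ x : ℝ, Integrable (fun ω => H (x + ∑ i, a i * ε i ω)) P ∧
        ∫ ω, H (x + ∑ i, a i * ε i ω) ∂P = symAvgList (List.ofFn a) H x
  | 0, a, ε, _, _, x => by simp [symAvgList]
  | n + 1, a, ε, hlaw, hind, x => by
    have hm : ∀ i, AEMeasurable (ε i) P := fun i => (hlaw i).aemeasurable
    set R : Ω → ℝ := fun ω => ∑ i : Fin n, a i.succ * ε i.succ ω with hR
    have hindR : IndepFun (ε 0) R P := by
      have h := hind.indepFun_finset₀ {0} (Finset.univ.map (Fin.succEmb n))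
        (by simp) hm
      have hφ : Measurable fun z : ({0} : Finset (Fin (n + 1))) → ℝ => z ⟨0, by simp⟩ :=
        measurable_pi_apply _
      have hψ : Measurable fun z : (Finset.univ.map (Fin.succEmb n) : Finset (Fin (n + 1))) → ℝ =>
          ∑ i : Fin n, a i.succ * z ⟨i.succ, by simp⟩ := by fun_prop
      exact h.comp hφ hψ
    have IH := integral_rademacher_sum hH n (fun i => a i.succ) (fun i => ε i.succ)
      (fun i => hlaw i.succ) (hind.precomp (Fin.succ_injective n))
    obtain ⟨hp1, hp2⟩ := IH (x + a 0)
    obtain ⟨hn1, hn2⟩ := IH (x - a 0)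
    have hw1 := integral_of_hasLaw_rademacherReal (hlaw 0) (fun e => (1 + e) / 2) (by fun_prop)
    have hw2 := integral_of_hasLaw_rademacherReal (hlaw 0) (fun e => (1 - e) / 2) (by fun_prop)
    have hi1 : IndepFun (fun ω => (1 + ε 0 ω) / 2) (fun ω => H (x + a 0 + R ω)) P :=
      hindR.comp (φ := fun e => (1 + e) / 2) (ψ := fun r => H (x + a 0 + r))
        (by fun_prop) (hH.comp (by fun_prop)).measurable
    have hi2 : IndepFun (fun ω => (1 - ε 0 ω) / 2) (fun ω => H (x - a 0 + R ω)) P :=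
      hindR.comp (φ := fun e => (1 - e) / 2) (ψ := fun r => H (x - a 0 + r))
        (by fun_prop) (hH.comp (by fun_prop)).measurable
    have hI1 := hi1.integrable_mul hw1.1 hp1
    have hI2 := hi2.integrable_mul hw2.1 hn1
    -- `(1 ± ε) / 2` are the indicators of the events `ε = ±1`
    have hae : (fun ω => H (x + ∑ i, a i * ε i ω)) =ᵐ[P]
        (fun ω => (1 + ε 0 ω) / 2) * (fun ω => H (x + a 0 + R ω))
          + (fun ω => (1 - ε 0 ω) / 2) * (fun ω => H (x - a 0 + R ω)) := by
      filter_upwards [ae_eq_one_or_neg_one_of_hasLaw (hlaw 0)] with ω hω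
      rw [Fin.sum_univ_succ]
      rcases hω with h | h <;> simp [h, hR, ← add_assoc, sub_eq_add_neg]
    refine ⟨(hI1.add hI2).congr hae.symm, ?_⟩
    rw [integral_congr_ae hae, integral_add' hI1 hI2,
      hi1.integral_mul_eq_mul_integral hw1.1.aestronglyMeasurable hp1.aestronglyMeasurable,
      hi2.integral_mul_eq_mul_integral hw2.1.aestronglyMeasurable hn1.aestronglyMeasurable,
      hw1.2, hw2.2, hp2, hn2, List.ofFn_succ]
    simp only [symAvgList, symAvg]
    ring

theorem mainTheorem1 (p : ℝ) (hp : 3 ≤ p) :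
    ∃ C : ℝ, 0 < C ∧
      ∀ (n : ℕ) (a : Fin n → ℝ), Antitone a → (∀ i, 0 ≤ a i) → ∑ i, a i ^ 2 = 1 →
      ∀ (Ω : Type*) [MeasurableSpace Ω] (P : Measure Ω) [IsProbabilityMeasure P]
        (ε : Fin n → Ω → ℝ), (∀ i, HasLaw (ε i) rademacherReal P) → iIndepFun ε P →
      ∀ (Ω' : Type*) [MeasurableSpace Ω'] (P' : Measure Ω') [IsProbabilityMeasure P']
        (G : Ω' → ℝ), HasLaw G (gaussianReal 0 1) P' →
        ∫ ω, |∑ i, a i * ε i ω| ^ p ∂P ≤ (∫ ω, |G ω| ^ p ∂P') - C * ∑ i, a i ^ 4 := by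
  refine ⟨gainConst / 8, div_pos gainConst_pos (by norm_num), ?_⟩
  intro n a _ ha hsum Ω _ P _ ε hlaw hind Ω' _ P' _ G hG
  have hc := continuous_abs_rpow (q := p) (by linarith)
  have hS := (integral_rademacher_sum hc n a ε hlaw hind 0).2
  have hGp : ∫ ω, |G ω| ^ p ∂P' = gaussMoment p 1 0 := by
    simp only [gaussMoment, zero_add]
    rw [← hG.map_eq, integral_map hG.aemeasurable hc.aestronglyMeasurable]
  have hF0 : gaussMoment p 0 = fun x => |x| ^ p := by
    funext x
    simp [gaussMoment]
  -- each sign is split into two halves of size `a i / √2`, one of which becomes Gaussian first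
  set l : List ℝ≥0 := List.ofFn fun i => (a i).toNNReal / NNReal.sqrt 2 with hl
  have h2 : NNReal.sqrt 2 ^ 2 = 2 := NNReal.sq_sqrt 2
  have hla : (l.map fun b : ℝ≥0 => √2 * (b : ℝ)) = List.ofFn a := by
    rw [hl, List.map_ofFn]
    congr 1
    funext i
    simp only [Function.comp, NNReal.coe_div, Real.coe_toNNReal _ (ha i), Real.coe_sqrt]
    push_cast
    field_simp
  have hl2 : (l.map fun b => b ^ 2).sum = 1 / 2 := by
    rw [hl, List.map_ofFn, List.sum_ofFn]
    simp only [Function.comp, div_pow, h2]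
    rw [← Finset.sum_div]
    congr 1
    rw [← NNReal.coe_inj]
    push_cast
    simpa [Real.coe_toNNReal _ (ha _)] using hsum
  have hl4 : (((l.map fun b => b ^ 4).sum : ℝ≥0) : ℝ) = (∑ i, a i ^ 4) / 4 := by
    rw [hl, List.map_ofFn, List.sum_ofFn]
    have h4 : NNReal.sqrt 2 ^ 4 = 4 := by
      rw [show NNReal.sqrt 2 ^ 4 = (NNReal.sqrt 2 ^ 2) ^ 2 by ring, h2]; norm_num
    simp only [Function.comp, div_pow, h4]
    rw [← Finset.sum_div]
    push_cast
    simp [Real.coe_toNNReal _ (ha _)]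
  have hhalf : (1 / 2 : ℝ≥0) + 1 / 2 = 1 := add_halves 1
  have step1 := symAvgList_gaussMoment_le hp l 0 0
  have step2 := symAvgList_gaussMoment_add_le hp (v := 1 / 2) (by simp) l
    (by rw [hl2, hhalf]; simp) 0
  rw [hla, hF0, hl2, zero_add] at step1
  rw [hl2, hl4, hhalf] at step2
  simp only [zero_add] at hS
  rw [hS, hGp]
  push_cast at step2
  linarith
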